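/- For integers $\alpha,\beta,\gamma\ge 1$, at most one of which equals $1$, the theta graph $\Theta(\alpha,\beta,\gamma)$ is the graph formed by three paths $x_0,\dots,x_\alpha$, $y_0,\dots,y_\beta$ and $z_0,\dots,z_\gamma$ with common endpoints $x_0=y_0=z_0$ and $x_\alpha=y_\beta=z_\gamma$, all remaining vertices being mutually different; its edges are exactly the edges of the three paths. A connected graph $G=(V,E)$ with graph distance $d$ is of QE class if it admits a quadratic embedding, that is, if there are a Hilbert space $\mathcal H$ and a map $\phi:V\to\mathcal H$ such that $\|\phi(u)-\phi(v)\|^2=d(u,v)$ for all $u,v\in V$. Theorem 1. Let $\alpha,\beta,\gamma$ be integers with $1\le\alpha\le\beta\le\gamma$ and $\beta\ge 2$. Then $\Theta(\alpha,\beta,\gamma)$ is of QE class if and only if either $\alpha=1$, or $\alpha=2$, $\beta=3$ and $\gamma\in\{3,5,7\}$. -/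

import Mathlib

/-- The vertices of the theta graph `Θ(α, β, γ)`: the two common endpoints
(`Sum.inl false` is the initial one, `Sum.inl true` the terminal one) and the
`α - 1`, `β - 1`, `γ - 1` inner vertices of the three paths. -/
abbrev ThetaVertex (α β γ : ℕ) : Type :=
  Bool ⊕ (Fin (α - 1) ⊕ (Fin (β - 1) ⊕ Fin (γ - 1)))

namespace ThetaVertex

/-- The `j`-th vertex (`0 ≤ j ≤ n`) of a path with `n` edges from `s` to `t` whose inner
vertices, numbered `1, …, n - 1` along the path, are listed by `inner`. -/
def along {V : Type} (n : ℕ) (s t : V) (inner : Fin (n - 1) → V) (j : ℕ) : V :=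
  if j = 0 then s else if h : j - 1 < n - 1 then inner ⟨j - 1, h⟩ else t

variable {α β γ : ℕ}

/-- The vertex `x_j` of the first path, `0 ≤ j ≤ α`. -/
def x (j : ℕ) : ThetaVertex α β γ :=
  along α (Sum.inl false) (Sum.inl true) (fun i => Sum.inr (Sum.inl i)) j

/-- The vertex `y_j` of the second path, `0 ≤ j ≤ β`. -/
def y (j : ℕ) : ThetaVertex α β γ :=
  along β (Sum.inl false) (Sum.inl true) (fun i => Sum.inr (Sum.inr (Sum.inl i))) j

/-- The vertex `z_j` of the third path, `0 ≤ j ≤ γ`. -/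
def z (j : ℕ) : ThetaVertex α β γ :=
  along γ (Sum.inl false) (Sum.inl true) (fun i => Sum.inr (Sum.inr (Sum.inr i))) j

end ThetaVertex

/-- The theta graph `Θ(α, β, γ)` for `α, β, γ ≥ 1`: three paths `x_0, …, x_α`, `y_0, …, y_β` and
`z_0, …, z_γ` with common endpoints `x_0 = y_0 = z_0` and `x_α = y_β = z_γ`, all the other
vertices being mutually different. The edges are those of the three paths. -/
def thetaGraph (α β γ : ℕ) : SimpleGraph (ThetaVertex α β γ) :=
  SimpleGraph.fromRel fun u v =>
    (∃ j < α, u = ThetaVertex.x j ∧ v = ThetaVertex.x (j + 1)) ∨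
    (∃ j < β, u = ThetaVertex.y j ∧ v = ThetaVertex.y (j + 1)) ∨
    (∃ j < γ, u = ThetaVertex.z j ∧ v = ThetaVertex.z (j + 1))

/-- `φ` is a quadratic embedding of the graph `G`: the squared distances of the images are the
graph distances. -/
def IsQuadraticEmbedding {V H : Type*} [NormedAddCommGroup H] (G : SimpleGraph V)
    (φ : V → H) : Prop :=
  ∀ u v : V, ‖φ u - φ v‖ ^ 2 = (G.dist u v : ℝ)

/-- A graph is of QE class if it is connected and admits a quadratic embedding in some Hilbert
space. Real Hilbert spaces suffice, since a complex one is also a real one with the same norm. -/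
def IsQEClass.{u} {V : Type u} (G : SimpleGraph V) : Prop :=
  G.Connected ∧
    ∃ (H : Type u) (_ : NormedAddCommGroup H) (_ : InnerProductSpace ℝ H) (_ : CompleteSpace H)
      (φ : V → H), IsQuadraticEmbedding G φ

/-!
By Schoenberg's criterion a quadratic embedding exists exactly when the distance matrix is
conditionally negative definite, so the proof evaluates the distances (`dist_thetaPt`), exhibits
vectors of sum zero with positive energy for the graphs to be excluded, and writes the distance as
a sum of squares for the others.

Suppose that all three paths have length at least `2`. If a cycle through a shortest path is even,
its antipodal pairs form rectangles in any quadratic embedding, and any point has the same sum of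
squared distances to the ends of both diagonals of a rectangle
(`IsQEClass.dist_add_dist_eq_of_rectangle`). The middle of the third path violates this
(`not_isQEClass_of_even_add`). Otherwise the two longer paths have the parity opposite to that of
the shortest one and form an even cycle. If `α ≥ 3`, this cycle contains two neighbouring antipodal
pairs at full distance, and they form a rectangle that excludes the graph in the same way
(`not_isQEClass_of_odd_add`). If `α = 2` and both longer paths have at least five edges, weights
on eleven vertices do (`not_isQEClass_two_odd_odd`). There remain the graphs `Θ(2, 3, 2 * k + 1)`.
Here `y 1` has a best approximation from the odd cycle of length `2 * k + 3`, and the squared norm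
of the difference is a positive multiple of `3 - k` (`not_isQEClass_two_three`). Thus only
`k = 1, 2, 3` survive, and these graphs have explicit embeddings (`isQEClass_of_sporadicCoord`).

If `α = 1`, the graph consists of two cycles glued along an edge. Twice the distance on a cycle
counts the cuts through two (almost) opposite edges, and the cuts of the two cycles that pass
through the common edge can be joined so that the same count holds on the whole graph
(`sum_symmDiffCard_thetaCut`). A count of separating cuts is a sum of squares.
-/

/-! ### The graph distance of a theta graph -/

/-- The lengths of the three paths, indexed by `0` (for `x`), `1` (for `y`) and `2` (for `z`). -/
def thetaLen (α β γ : ℕ) : Fin 3 → ℕ := ![α, β, γ]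

/-- The `j`-th vertex of the `k`-th path; meant for `j ≤ thetaLen α β γ k`. -/
def thetaPt {α β γ : ℕ} (k : Fin 3) (j : ℕ) : ThetaVertex α β γ :=
  match k with
  | 0 => ThetaVertex.x j
  | 1 => ThetaVertex.y j
  | 2 => ThetaVertex.z j

/-- A path and a position on it that describe a given vertex. The two endpoints are placed on
the path `0`. -/
def thetaLabel {α β γ : ℕ} : ThetaVertex α β γ → Fin 3 × ℕ
  | Sum.inl false => (0, 0)
  | Sum.inl true => (0, α)
  | Sum.inr (Sum.inl i) => (0, i + 1)
  | Sum.inr (Sum.inr (Sum.inl i)) => (1, i + 1)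
  | Sum.inr (Sum.inr (Sum.inr i)) => (2, i + 1)

/-- The distance between two positions when the path `0` is a shortest one: a geodesic passes
through no endpoint, through one of them, or through both, and then it uses the path `0`. -/
def thetaDist (α β γ : ℕ) (p q : Fin 3 × ℕ) : ℕ :=
  min
    (min (min (p.2 + q.2) (thetaLen α β γ p.1 - p.2 + (thetaLen α β γ q.1 - q.2)))
      (min (p.2 + (thetaLen α β γ q.1 - q.2) + α) (thetaLen α β γ p.1 - p.2 + q.2 + α)))
    (if p.1 = q.1 then max p.2 q.2 - min p.2 q.2 else p.2 + q.2)

section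

variable {α β γ : ℕ}

@[simp] theorem thetaLen_zero : thetaLen α β γ 0 = α := rfl
@[simp] theorem thetaLen_one : thetaLen α β γ 1 = β := rfl
@[simp] theorem thetaLen_two : thetaLen α β γ 2 = γ := rfl

theorem le_thetaLen (hβ : α ≤ β) (hγ : α ≤ γ) (k : Fin 3) : α ≤ thetaLen α β γ k := by
  fin_cases k <;> simp [thetaLen, *]

theorem thetaPt_zero (k : Fin 3) : (thetaPt k 0 : ThetaVertex α β γ) = Sum.inl false := by
  fin_cases k <;> rfl

theorem thetaPt_len (hα : 1 ≤ α) (hβ : α ≤ β) (hγ : α ≤ γ) (k : Fin 3) :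
    (thetaPt k (thetaLen α β γ k) : ThetaVertex α β γ) = Sum.inl true := by
  have h1 : β ≠ 0 := by omega
  have h2 : γ ≠ 0 := by omega
  have h3 : α ≠ 0 := by omega
  fin_cases k <;>
    simp [thetaPt, ThetaVertex.x, ThetaVertex.y, ThetaVertex.z, ThetaVertex.along, h1, h2, h3]

theorem thetaLabel_thetaPt {k : Fin 3} {j : ℕ} (h0 : 0 < j) (hj : j < thetaLen α β γ k) :
    thetaLabel (thetaPt k j : ThetaVertex α β γ) = (k, j) := by
  have h1 : j ≠ 0 := by omega
  have h2 : j - 1 < thetaLen α β γ k - 1 := by omega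
  fin_cases k <;>
    simp_all [thetaPt, ThetaVertex.x, ThetaVertex.y, ThetaVertex.z, ThetaVertex.along,
      thetaLabel, thetaLen] <;> omega

theorem thetaPt_thetaLabel (hα : 1 ≤ α) (v : ThetaVertex α β γ) :
    thetaPt (thetaLabel v).1 (thetaLabel v).2 = v := by
  have h3 : α ≠ 0 := by omega
  rcases v with (_ | _) | i | i | i <;>
    simp [thetaPt, thetaLabel, ThetaVertex.x, ThetaVertex.y, ThetaVertex.z, ThetaVertex.along, h3]

theorem thetaLabel_snd_le (v : ThetaVertex α β γ) :
    (thetaLabel v).2 ≤ thetaLen α β γ (thetaLabel v).1 := by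
  rcases v with (_ | _) | i | i | i <;> simp [thetaLabel] <;> omega

theorem exists_eq_thetaPt (hα : 1 ≤ α) (v : ThetaVertex α β γ) :
    ∃ k j, j ≤ thetaLen α β γ k ∧ v = thetaPt k j :=
  ⟨_, _, thetaLabel_snd_le v, (thetaPt_thetaLabel hα v).symm⟩

theorem thetaGraph_adj_iff {u v : ThetaVertex α β γ} :
    (thetaGraph α β γ).Adj u v ↔ u ≠ v ∧ ∃ k, ∃ j < thetaLen α β γ k,
      (u = thetaPt k j ∧ v = thetaPt k (j + 1)) ∨ (v = thetaPt k j ∧ u = thetaPt k (j + 1)) := by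
  simp only [thetaGraph, SimpleGraph.fromRel_adj, Fin.exists_fin_succ, thetaPt]
  simp [thetaLen]
  grind

theorem thetaDist_comm (p q : Fin 3 × ℕ) : thetaDist α β γ p q = thetaDist α β γ q p := by
  simp only [thetaDist, eq_comm (a := p.1), max_comm p.2, min_comm p.2]
  split_ifs <;> omega

theorem thetaDist_thetaLabel (hα : 1 ≤ α) (hβ : α ≤ β) (hγ : α ≤ γ) {k l : Fin 3} {i j : ℕ}
    (hi : i ≤ thetaLen α β γ k) (hj : j ≤ thetaLen α β γ l) :
    thetaDist α β γ (k, i) (thetaLabel (thetaPt l j : ThetaVertex α β γ)) =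
      thetaDist α β γ (k, i) (l, j) := by
  have hk := le_thetaLen hβ hγ k
  have hl := le_thetaLen hβ hγ l
  rcases Nat.eq_zero_or_pos j with rfl | h0
  · rw [thetaPt_zero]
    simp only [thetaLabel, thetaDist, thetaLen_zero]
    by_cases h1 : k = 0 <;> by_cases h2 : k = l <;> subst_vars <;>
      simp_all only [thetaLen_zero, if_true, if_false] <;> omega
  rcases hj.lt_or_eq with h | rfl
  · rw [thetaLabel_thetaPt h0 h]
  · rw [thetaPt_len hα hβ hγ]
    simp only [thetaLabel, thetaDist, thetaLen_zero]
    by_cases h1 : k = 0 <;> by_cases h2 : k = l <;> subst_vars <;>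
      simp_all only [thetaLen_zero, if_true, if_false] <;> omega

theorem thetaDist_succ (k l : Fin 3) (i : ℕ) {j : ℕ} (hj : j < thetaLen α β γ l) :
    thetaDist α β γ (k, i) (l, j) ≤ thetaDist α β γ (k, i) (l, j + 1) + 1 ∧
      thetaDist α β γ (k, i) (l, j + 1) ≤ thetaDist α β γ (k, i) (l, j) + 1 := by
  have key {a b c d : ℕ} (h1 : a ≤ c + 1) (h2 : b ≤ d + 1) : min a b ≤ min c d + 1 := by omega
  simp only [thetaDist]
  constructor <;> refine key (key (key ?_ ?_) (key ?_ ?_)) ?_ <;> try split_ifs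
  all_goals omega

/-- Two vertices of the same path are joined by the piece of that path between them. -/
theorem exists_walk_thetaPt (k : Fin 3) (i d : ℕ) (h : i + d ≤ thetaLen α β γ k) :
    ∃ p : (thetaGraph α β γ).Walk (thetaPt k i) (thetaPt k (i + d)), p.length ≤ d := by
  induction d with
  | zero => exact ⟨.nil, le_rfl⟩
  | succ d ih =>
    obtain ⟨p, hp⟩ := ih (by omega)
    by_cases he : (thetaPt k (i + d) : ThetaVertex α β γ) = thetaPt k (i + (d + 1))
    · exact ⟨p.copy rfl he, by simpa using hp.trans (Nat.le_succ d)⟩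
    · refine ⟨p.concat (thetaGraph_adj_iff.2 ⟨he, k, i + d, by omega, Or.inl ⟨rfl, rfl⟩⟩), ?_⟩
      simpa using hp

theorem thetaGraph_connected (hα : 1 ≤ α) : (thetaGraph α β γ).Connected := by
  have key : ∀ v, (thetaGraph α β γ).Reachable (Sum.inl false) v := by
    intro v
    obtain ⟨k, j, hj, rfl⟩ := exists_eq_thetaPt hα v
    obtain ⟨p, -⟩ := exists_walk_thetaPt (α := α) (β := β) (γ := γ) k 0 j (by omega)
    rw [← thetaPt_zero k]
    simpa using p.reachable
  exact { preconnected := fun u v => (key u).symm.trans (key v), nonempty := ⟨Sum.inl false⟩ }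

theorem dist_thetaPt_le (k : Fin 3) {i j : ℕ} (hij : i ≤ j) (h : j ≤ thetaLen α β γ k) :
    (thetaGraph α β γ).dist (thetaPt k i) (thetaPt k j) ≤ j - i := by
  obtain ⟨d, rfl⟩ := Nat.exists_eq_add_of_le hij
  obtain ⟨p, hp⟩ := exists_walk_thetaPt (α := α) (β := β) (γ := γ) k i d h
  have := SimpleGraph.dist_le p
  omega

theorem SimpleGraph.Walk.le_add_length {V : Type*} {G : SimpleGraph V} {f : V → ℕ}
    (hf : ∀ u v, G.Adj u v → f v ≤ f u + 1) {u v : V} (p : G.Walk u v) :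
    f v ≤ f u + p.length := by
  induction p with
  | nil => simp
  | cons h p ih =>
    have := hf _ _ h
    rw [SimpleGraph.Walk.length_cons]
    omega

theorem thetaDist_le_dist (hα : 1 ≤ α) (hβ : α ≤ β) (hγ : α ≤ γ) {k l : Fin 3} {i j : ℕ}
    (hi : i ≤ thetaLen α β γ k) (hj : j ≤ thetaLen α β γ l) :
    thetaDist α β γ (k, i) (l, j) ≤ (thetaGraph α β γ).dist (thetaPt k i) (thetaPt l j) := by
  obtain ⟨p, hp⟩ := (thetaGraph_connected (β := β) (γ := γ) hα).exists_walk_length_eq_dist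
    (thetaPt k i) (thetaPt l j)
  have := p.le_add_length (f := fun v => thetaDist α β γ (k, i) (thetaLabel v)) (by
    intro u v huv
    obtain ⟨-, m, c, hc, h⟩ := thetaGraph_adj_iff.1 huv
    have h1 := thetaDist_succ (α := α) (β := β) (γ := γ) k m i hc
    have h2 := thetaDist_thetaLabel hα hβ hγ hi hc.le
    have h3 := thetaDist_thetaLabel hα hβ hγ hi (Nat.succ_le_of_lt hc)
    rcases h with ⟨rfl, rfl⟩ | ⟨rfl, rfl⟩ <;> simp only [Nat.succ_eq_add_one] at * <;> omega)
  simp only [thetaDist_thetaLabel hα hβ hγ hi hi, thetaDist_thetaLabel hα hβ hγ hi hj] at this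
  have h0 : thetaDist α β γ (k, i) (k, i) = 0 := by simp [thetaDist]
  omega

theorem dist_thetaPt (hα : 1 ≤ α) (hβ : α ≤ β) (hγ : α ≤ γ) {k l : Fin 3} {i j : ℕ}
    (hi : i ≤ thetaLen α β γ k) (hj : j ≤ thetaLen α β γ l) :
    (thetaGraph α β γ).dist (thetaPt k i) (thetaPt l j) = thetaDist α β γ (k, i) (l, j) := by
  refine le_antisymm ?_ (thetaDist_le_dist hα hβ hγ hi hj)
  have hc := thetaGraph_connected (β := β) (γ := γ) hα
  -- the distances of the two vertices to the two endpoints, and that of the endpoints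
  have s1 := dist_thetaPt_le (α := α) (β := β) (γ := γ) k (Nat.zero_le i) hi
  have s2 := dist_thetaPt_le (α := α) (β := β) (γ := γ) l (Nat.zero_le j) hj
  have t1 := dist_thetaPt_le (α := α) (β := β) (γ := γ) k hi le_rfl
  have t2 := dist_thetaPt_le (α := α) (β := β) (γ := γ) l hj le_rfl
  have st := dist_thetaPt_le (α := α) (β := β) (γ := γ) 0 (Nat.zero_le _) le_rfl
  rw [thetaPt_zero] at s1 s2 st
  rw [thetaPt_len hα hβ hγ] at t1 t2 st
  rw [SimpleGraph.dist_comm] at s1 t2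
  have d1 := hc.dist_triangle (u := thetaPt k i) (v := Sum.inl false) (w := thetaPt l j)
  have d2 := hc.dist_triangle (u := thetaPt k i) (v := Sum.inl true) (w := thetaPt l j)
  have d3 := hc.dist_triangle (u := Sum.inl false) (v := Sum.inl true) (w := thetaPt l j)
  have d4 := hc.dist_triangle (u := Sum.inl true) (v := Sum.inl false) (w := thetaPt l j)
  rw [SimpleGraph.dist_comm (u := Sum.inl true) (v := Sum.inl false)] at d4
  have same : k = l →
      (thetaGraph α β γ).dist (thetaPt k i) (thetaPt l j) ≤ max i j - min i j := by
    rintro rfl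
    rcases le_total i j with h | h
    · have := dist_thetaPt_le (α := α) (β := β) (γ := γ) k h hj
      omega
    · have := dist_thetaPt_le (α := α) (β := β) (γ := γ) k h hi
      rw [SimpleGraph.dist_comm] at this
      omega
  simp only [thetaLen_zero] at st
  simp only [thetaDist]
  split_ifs with h
  · have := same h
    omega
  · omega

end

/-! ### Criteria for quadratic embeddings -/

/-- A squared distance that is a nonnegative combination of squared differences of real functions
is realised in a Euclidean space. -/
theorem isQEClass_of_sum_sq {V : Type} {G : SimpleGraph V} (hG : G.Connected) {κ : Type}
    [Fintype κ] (w : κ → ℝ) (hw : ∀ k, 0 ≤ w k) (f : V → κ → ℝ)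
    (h : ∀ u v, ∑ k, w k * (f u k - f v k) ^ 2 = (G.dist u v : ℝ)) : IsQEClass G := by
  refine ⟨hG, EuclideanSpace ℝ κ, inferInstance, inferInstance, inferInstance,
    fun v => WithLp.toLp 2 fun k => √(w k) * f v k, fun u v => ?_⟩
  rw [EuclideanSpace.norm_sq_eq, ← h u v]
  refine Finset.sum_congr rfl fun k _ => ?_
  simp only [PiLp.sub_apply, Real.norm_eq_abs, sq_abs]
  rw [← mul_sub, mul_pow, Real.sq_sqrt (hw k)]

/-- The easy half of Schoenberg's criterion: the distances of a graph of QE class form a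
conditionally negative definite kernel. -/
theorem IsQEClass.sum_sum_mul_dist_nonpos {V : Type} {G : SimpleGraph V} (hG : IsQEClass G)
    {ι : Type*} [Fintype ι] (p : ι → V) (f : ι → ℤ) (hf : ∑ i, f i = 0) :
    ∑ i, ∑ j, f i * f j * (G.dist (p i) (p j) : ℤ) ≤ 0 := by
  obtain ⟨-, H, _, _, _, φ, hφ⟩ := hG
  have hf' : ∑ i, (f i : ℝ) = 0 := by exact_mod_cast hf
  have h := inner_sum_smul_sum_smul_of_sum_eq_zero (fun i => φ (p i)) hf' (fun i => φ (p i)) hf'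
  have h0 := real_inner_self_nonneg (x := ∑ i, (f i : ℝ) • φ (p i))
  simp only [← sq, hφ _ _] at h
  rw [h] at h0
  have : (∑ i, ∑ j, (f i : ℝ) * f j * (G.dist (p i) (p j) : ℝ)) ≤ 0 := by linarith
  exact_mod_cast this

/-- Four vertices at the distances of a rectangle with sides `√a` and `√b` are mapped to the
vertices of a rectangle. Hence the sums of the squared distances of any further point to the ends
of the two diagonals agree. -/
theorem IsQEClass.dist_add_dist_eq_of_rectangle {V : Type} {G : SimpleGraph V}
    (hG : IsQEClass G) {p q r t : V} {a b : ℕ} (hpr : G.dist p r = a) (hqt : G.dist q t = a)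
    (hrq : G.dist r q = b) (hpt : G.dist p t = b) (hpq : G.dist p q = a + b)
    (hrt : G.dist r t = a + b) (w : V) :
    G.dist w p + G.dist w q = G.dist w r + G.dist w t := by
  obtain ⟨-, H, _, _, _, φ, hφ⟩ := hG
  have e (u v : V) : ‖φ u‖ ^ 2 - 2 * inner ℝ (φ u) (φ v) + ‖φ v‖ ^ 2 = (G.dist u v : ℝ) := by
    rw [← hφ, norm_sub_sq_real]
  have e1 := e p r
  have e2 := e q t
  have e3 := e r q
  have e4 := e p t
  have e5 := e p q
  have e6 := e r t
  rw [hpr] at e1; rw [hqt] at e2; rw [hrq] at e3; rw [hpt] at e4; rw [hpq] at e5; rw [hrt] at e6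
  push_cast at e1 e2 e3 e4 e5 e6
  have h0 : φ p + φ q = φ r + φ t := by
    rw [← sub_eq_zero, ← inner_self_eq_zero (𝕜 := ℝ)]
    simp only [inner_sub_left, inner_sub_right, inner_add_left, inner_add_right,
      real_inner_self_eq_norm_sq]
    have c1 := real_inner_comm (φ p) (φ q)
    have c2 := real_inner_comm (φ p) (φ r)
    have c3 := real_inner_comm (φ p) (φ t)
    have c4 := real_inner_comm (φ q) (φ r)
    have c5 := real_inner_comm (φ q) (φ t)
    have c6 := real_inner_comm (φ r) (φ t)
    linarith
  have h1 : (inner ℝ (φ w) (φ p) : ℝ) + inner ℝ (φ w) (φ q) =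
      inner ℝ (φ w) (φ r) + inner ℝ (φ w) (φ t) := by
    rw [← inner_add_right, h0, inner_add_right]
  have h2 : (inner ℝ (φ p) (φ p) : ℝ) + inner ℝ (φ p) (φ q) =
      inner ℝ (φ p) (φ r) + inner ℝ (φ p) (φ t) := by
    rw [← inner_add_right, h0, inner_add_right]
  rw [real_inner_self_eq_norm_sq] at h2
  have f1 := e w p
  have f2 := e w q
  have f3 := e w r
  have f4 := e w t
  have : (G.dist w p : ℝ) + G.dist w q = G.dist w r + G.dist w t := by linarith
  exact_mod_cast this

/-! ### Obstructions from rectangles -/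

section

variable {α β γ : ℕ}

/-- If the cycle formed by the shortest path and the path `b` is even, then antipodal pairs of
this isometric cycle form rectangles, and the middle of the third path `c` sees the diagonal
through an endpoint and the next diagonal differently. -/
theorem not_isQEClass_of_even_add (hα : 2 ≤ α) (hβ : α ≤ β) (hγ : α ≤ γ) {b c : Fin 3}
    (hb : b ≠ 0) (hc : c ≠ 0) (hbc : b ≠ c) (he : Even (α + thetaLen α β γ b)) :
    ¬ IsQEClass (thetaGraph α β γ) := by
  intro hG
  obtain ⟨h, hh⟩ := he
  have hb' := le_thetaLen hβ hγ b
  have hc' := le_thetaLen hβ hγ c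
  have d {k l : Fin 3} {i j : ℕ} (hi : i ≤ thetaLen α β γ k) (hj : j ≤ thetaLen α β γ l) :=
    dist_thetaPt (by omega : 1 ≤ α) hβ hγ hi hj
  have h0 : (0 : ℕ) ≤ thetaLen α β γ 0 := Nat.zero_le _
  have h1 : (1 : ℕ) ≤ thetaLen α β γ 0 := by rw [thetaLen_zero]; omega
  have h2 : h ≤ thetaLen α β γ b := by omega
  have h3 : h - 1 ≤ thetaLen α β γ b := by omega
  have h4 : thetaLen α β γ c / 2 ≤ thetaLen α β γ c := by omega
  have := hG.dist_add_dist_eq_of_rectangle (p := thetaPt 0 0) (q := thetaPt b h)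
    (r := thetaPt 0 1) (t := thetaPt b (h - 1)) (a := 1) (b := h - 1)
    (by rw [d h0 h1]; simp only [thetaDist, thetaLen_zero, if_true]; omega)
    (by rw [d h2 h3]; simp only [thetaDist, if_true]; omega)
    (by rw [d h1 h2]; simp only [thetaDist, thetaLen_zero, hb.symm, if_false]; omega)
    (by rw [d h0 h3]; simp only [thetaDist, thetaLen_zero, hb.symm, if_false]; omega)
    (by rw [d h0 h2]; simp only [thetaDist, thetaLen_zero, hb.symm, if_false]; omega)
    (by rw [d h1 h3]; simp only [thetaDist, thetaLen_zero, hb.symm, if_false]; omega)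
    (thetaPt c (thetaLen α β γ c / 2))
  rw [d h4 h0, d h4 h1, d h4 h2, d h4 h3] at this
  simp only [thetaDist, thetaLen_zero, hc, hbc.symm, if_false] at this
  omega

/-- If the cycle formed by the two longer paths is even, then those of its antipodal pairs that
stay away from the endpoints have the distances of the cycle, and the vertex `x 1` sees two
neighbouring diagonals differently. -/
theorem not_isQEClass_of_odd_add (hα : 3 ≤ α) (hβ : α ≤ β) (hγ : β ≤ γ) (ho : Odd (α + β))
    (he : Even (β + γ)) : ¬ IsQEClass (thetaGraph α β γ) := by
  intro hG
  obtain ⟨a, rfl⟩ : ∃ a, α = a + 3 := ⟨α - 3, by omega⟩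
  obtain ⟨j, rfl⟩ : ∃ j, β = 2 * j + a + 2 := by
    obtain ⟨m, hm⟩ := ho
    exact ⟨m - a - 2, by omega⟩
  obtain ⟨e, rfl⟩ : ∃ e, γ = 2 * j + a + 2 + 2 * e := by
    obtain ⟨h, hh⟩ := he
    exact ⟨h - (2 * j + a + 2), by omega⟩
  clear ho he
  -- the antipode of the position `j` on the path `1` is `j + a + 2 + e` on the path `2`
  have d {k l : Fin 3} {i j' : ℕ} (hi : i ≤ thetaLen (a + 3) (2 * j + a + 2) _ k)
      (hj : j' ≤ thetaLen (a + 3) (2 * j + a + 2) (2 * j + a + 2 + 2 * e) l) :=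
    dist_thetaPt (by omega : 1 ≤ a + 3) hβ (hβ.trans hγ) hi hj
  have h1 : 1 ≤ thetaLen (a + 3) (2 * j + a + 2) (2 * j + a + 2 + 2 * e) 0 := by
    rw [thetaLen_zero]; omega
  have h2 : j ≤ thetaLen (a + 3) (2 * j + a + 2) (2 * j + a + 2 + 2 * e) 1 := by
    rw [thetaLen_one]; omega
  have h3 : j + 1 ≤ thetaLen (a + 3) (2 * j + a + 2) (2 * j + a + 2 + 2 * e) 1 := by
    rw [thetaLen_one]; omega
  have h4 : j + a + 2 + e ≤ thetaLen (a + 3) (2 * j + a + 2) (2 * j + a + 2 + 2 * e) 2 := by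
    rw [thetaLen_two]; omega
  have h5 : j + a + 1 + e ≤ thetaLen (a + 3) (2 * j + a + 2) (2 * j + a + 2 + 2 * e) 2 := by
    rw [thetaLen_two]; omega
  have n01 : (0 : Fin 3) ≠ 1 := by decide
  have n02 : (0 : Fin 3) ≠ 2 := by decide
  have n12 : (1 : Fin 3) ≠ 2 := by decide
  have e1 := (d h2 h3).trans (c := 1) (by
    simp only [thetaDist, thetaLen_one, if_true]; omega)
  have e2 := (d h4 h5).trans (c := 1) (by
    simp only [thetaDist, thetaLen_two, if_true]; omega)
  have e3 := (d h3 h4).trans (c := 2 * j + a + 1 + e) (by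
    simp only [thetaDist, thetaLen_one, thetaLen_two, n12, if_false]; omega)
  have e4 := (d h2 h5).trans (c := 2 * j + a + 1 + e) (by
    simp only [thetaDist, thetaLen_one, thetaLen_two, n12, if_false]; omega)
  have e5 := (d h2 h4).trans (c := 1 + (2 * j + a + 1 + e)) (by
    simp only [thetaDist, thetaLen_one, thetaLen_two, n12, if_false]; omega)
  have e6 := (d h3 h5).trans (c := 1 + (2 * j + a + 1 + e)) (by
    simp only [thetaDist, thetaLen_one, thetaLen_two, n12, if_false]; omega)
  have e7 := (d h1 h2).trans (c := j + 1) (by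
    simp only [thetaDist, thetaLen_zero, thetaLen_one, n01, if_false]; omega)
  have e8 := (d h1 h3).trans (c := j + 2) (by
    simp only [thetaDist, thetaLen_zero, thetaLen_one, n01, if_false]; omega)
  have e9 := (d h1 h4).trans (c := j + a + 2 + e) (by
    simp only [thetaDist, thetaLen_zero, thetaLen_two, n02, if_false]; omega)
  have e10 := (d h1 h5).trans (c := j + a + 2 + e) (by
    simp only [thetaDist, thetaLen_zero, thetaLen_two, n02, if_false]; omega)
  have := hG.dist_add_dist_eq_of_rectangle e1 e2 e3 e4 e5 e6 (thetaPt 0 1)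
  rw [e7, e8, e9, e10] at this
  omega

end

/-! ### Obstructions from weights: odd longer paths around a path of length two -/

set_option maxHeartbeats 1000000 in
/-- The configuration consists of the three vertices of the path `0` and the four middle vertices
of each longer path, with weights invariant under the reflection of the graph. In the reflection
invariant part, after projecting off the endpoints, two inner vertices of different longer paths
have nonzero inner product only if both are middle vertices. Weights `1` on the middle vertices
and `-1` on their neighbours would give the energy zero. The ratio `-(N + 1) / N` improves on
this in first order, and `N` is so large that the second order loss is smaller. -/
theorem not_isQEClass_two_odd_odd (a b : ℕ) :
    ¬ IsQEClass (thetaGraph 2 (2 * a + 5) (2 * b + 5)) := by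
  intro hG
  have d {k l : Fin 3} {i j : ℕ} (hi : i ≤ thetaLen 2 (2 * a + 5) (2 * b + 5) k)
      (hj : j ≤ thetaLen 2 (2 * a + 5) (2 * b + 5) l) :=
    dist_thetaPt (by omega : 1 ≤ 2) (by omega) (by omega) hi hj
  let x (e : Fin 3) : ThetaVertex 2 (2 * a + 5) (2 * b + 5) := thetaPt 0 e
  let y (i : Fin 4) : ThetaVertex 2 (2 * a + 5) (2 * b + 5) := thetaPt 1 (a + 1 + i)
  let z (i : Fin 4) : ThetaVertex 2 (2 * a + 5) (2 * b + 5) := thetaPt 2 (b + 1 + i)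
  have hx (e : Fin 3) : (e : ℕ) ≤ thetaLen 2 (2 * a + 5) (2 * b + 5) 0 := by
    rw [thetaLen_zero]; omega
  have hy (i : Fin 4) : a + 1 + i ≤ thetaLen 2 (2 * a + 5) (2 * b + 5) 1 := by
    rw [thetaLen_one]; omega
  have hz (i : Fin 4) : b + 1 + i ≤ thetaLen 2 (2 * a + 5) (2 * b + 5) 2 := by
    rw [thetaLen_two]; omega
  have n01 : (0 : Fin 3) ≠ 1 := by decide
  have n02 : (0 : Fin 3) ≠ 2 := by decide
  have n12 : (1 : Fin 3) ≠ 2 := by decide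
  have xx (e e' : Fin 3) : (thetaGraph 2 (2 * a + 5) (2 * b + 5)).dist (x e) (x e') =
      max (e : ℕ) e' - min (e : ℕ) e' := (d (hx e) (hx e')).trans (by
    simp only [thetaDist, thetaLen_zero, if_true]; omega)
  have yy (i j : Fin 4) : (thetaGraph 2 (2 * a + 5) (2 * b + 5)).dist (y i) (y j) =
      max (i : ℕ) j - min (i : ℕ) j := (d (hy i) (hy j)).trans (by
    simp only [thetaDist, thetaLen_one, if_true]; omega)
  have zz (i j : Fin 4) : (thetaGraph 2 (2 * a + 5) (2 * b + 5)).dist (z i) (z j) =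
      max (i : ℕ) j - min (i : ℕ) j := (d (hz i) (hz j)).trans (by
    simp only [thetaDist, thetaLen_two, if_true]; omega)
  have xy (e : Fin 3) (i : Fin 4) : (thetaGraph 2 (2 * a + 5) (2 * b + 5)).dist (x e) (y i) =
      a + 1 + min (e + i : ℕ) (5 - (e + i)) := (d (hx e) (hy i)).trans (by
    simp only [thetaDist, thetaLen_zero, thetaLen_one, n01, if_false]; omega)
  have xz (e : Fin 3) (i : Fin 4) : (thetaGraph 2 (2 * a + 5) (2 * b + 5)).dist (x e) (z i) =
      b + 1 + min (e + i : ℕ) (5 - (e + i)) := (d (hx e) (hz i)).trans (by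
    simp only [thetaDist, thetaLen_zero, thetaLen_two, n02, if_false]; omega)
  have yz (i j : Fin 4) : (thetaGraph 2 (2 * a + 5) (2 * b + 5)).dist (y i) (z j) =
      a + b + 2 + min (min (i + j : ℕ) (6 - (i + j))) (min (5 + i - j) (5 + j - i)) :=
    (d (hy i) (hz j)).trans (by
      simp only [thetaDist, thetaLen_one, thetaLen_two, n12, if_false]; omega)
  have yx (e : Fin 3) (i : Fin 4) := SimpleGraph.dist_comm.trans (xy e i)
  have zx (e : Fin 3) (i : Fin 4) := SimpleGraph.dist_comm.trans (xz e i)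
  have zy (i j : Fin 4) := SimpleGraph.dist_comm.trans (yz i j)
  clear_value x y z
  let N : ℤ := 2 * (a + b + 4)
  have h := hG.sum_sum_mul_dist_nonpos (Sum.elim y (Sum.elim z x))
    (Sum.elim ![-(N + 1), N, N, -(N + 1)] (Sum.elim ![-(N + 1), N, N, -(N + 1)]
      ![-(N - 2), 2 * N, -(N - 2)])) (by
    simp [Fintype.sum_sum_type, Fin.sum_univ_four, Fin.sum_univ_three]; ring)
  simp only [Fintype.sum_sum_type, Fin.sum_univ_four, Fin.sum_univ_three, Sum.elim_inl,
    Sum.elim_inr, xx, yy, zz, xy, xz, yz, yx, zx, zy] at h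
  simp [N] at h
  ring_nf at h
  linarith

/-- The sum of the distances from a vertex of the cycle of length `2 * k + 3` to all the others. -/
theorem sum_range_cycle_dist (k i : ℕ) (hi : i < 2 * k + 3) :
    ∑ j ∈ Finset.range (2 * k + 3),
      min (max i j - min i j) (2 * k + 3 - (max i j - min i j)) = (k + 1) * (k + 2) := by
  induction i with
  | zero =>
    simp only [Nat.zero_max, Nat.zero_min, Nat.sub_zero]
    clear hi
    induction k with
    | zero => decide
    | succ k ih =>
      rw [show 2 * (k + 1) + 3 = 2 * k + 3 + 1 + 1 by ring, Finset.sum_range_succ,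
        Finset.sum_range_succ', Finset.sum_congr rfl (g := fun j => min j (2 * k + 3 - j) + 1)
          (fun j hj => by have := Finset.mem_range.1 hj; omega), Finset.sum_add_distrib, ih]
      simp only [Finset.sum_const, Finset.card_range, smul_eq_mul]
      rw [show min (2 * k + 3 + 1) (2 * k + 3 + 1 + 1 - (2 * k + 3 + 1)) = 1 by omega,
        show min 0 (2 * k + 3 + 1 + 1 - 0) = 0 by omega]
      ring
  | succ i ih =>
    -- shifting the cycle by one step changes the sum by two terms, which are equal
    rw [← ih (by omega), show 2 * k + 3 = 2 * k + 2 + 1 by ring, Finset.sum_range_succ',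
      Finset.sum_range_succ _ (2 * k + 2)]
    refine congrArg₂ (· + ·) (Finset.sum_congr rfl fun j _ => ?_) ?_ <;> omega

/-- The sum of the distances from the vertex `y 1` of `Θ(2, 3, 2 * k + 1)` to the vertices of the
odd cycle of length `2 * k + 3`. -/
theorem sum_range_dist_to_cycle (k : ℕ) :
    ∑ j ∈ Finset.range (2 * k + 3), (if j = 0 then 2 else min j (2 * k + 4 - j)) =
      (k + 2) ^ 2 + 1 := by
  induction k with
  | zero => decide
  | succ k ih =>
    rw [Finset.sum_range_succ'] at ih
    rw [show 2 * (k + 1) + 3 = 2 * k + 2 + 1 + 1 + 1 by ring, Finset.sum_range_succ',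
      Finset.sum_range_succ, Finset.sum_range_succ',
      Finset.sum_congr rfl
        (g := fun j => (if j + 1 = 0 then 2 else min (j + 1) (2 * k + 4 - (j + 1))) + 1)
        (fun j hj => by
          have := Finset.mem_range.1 hj
          simp only [Nat.add_eq_zero_iff, one_ne_zero, and_false, if_false]
          omega), Finset.sum_add_distrib]
    simp only [Finset.sum_const, Finset.card_range, smul_eq_mul]
    simp only [Nat.add_eq_zero_iff, one_ne_zero, and_false, if_false, if_true, mul_one] at ih ⊢
    rw [show min (0 + 1) (2 * (k + 1) + 4 - (0 + 1)) = 1 by omega,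
      show min (2 * k + 3 + 1) (2 * (k + 1) + 4 - (2 * k + 3 + 1)) = 2 by omega]
    linarith

set_option maxHeartbeats 1000000 in
/-- The weights are a multiple of `y 1` minus its orthogonal projection to the affine hull of the
odd cycle formed by the paths `0` and `2`. The barycentric coordinates of this projection are
constant up to the three vertices `x 1`, `z k` and `z (k + 1)`. The energy of these weights is
`(2 * k + 3) * (2 * k - 6)`. -/
theorem not_isQEClass_two_three (k : ℕ) (hk : 4 ≤ k) :
    ¬ IsQEClass (thetaGraph 2 3 (2 * k + 1)) := by
  intro hG
  have d {k' l : Fin 3} {i j : ℕ} (hi : i ≤ thetaLen 2 3 (2 * k + 1) k')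
      (hj : j ≤ thetaLen 2 3 (2 * k + 1) l) :=
    dist_thetaPt (by omega : 1 ≤ 2) (by omega) (by omega) hi hj
  -- the odd cycle, starting from `x 1` and continuing along the path `2`
  let c (i : ℕ) : ThetaVertex 2 3 (2 * k + 1) := if i = 0 then thetaPt 0 1 else thetaPt 2 (i - 1)
  let y : ThetaVertex 2 3 (2 * k + 1) := thetaPt 1 1
  have h0 : 1 ≤ thetaLen 2 3 (2 * k + 1) 0 := by rw [thetaLen_zero]; omega
  have h1 : 1 ≤ thetaLen 2 3 (2 * k + 1) 1 := by rw [thetaLen_one]; omega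
  have h2 {i : ℕ} (hi : i < 2 * k + 3) : i - 1 ≤ thetaLen 2 3 (2 * k + 1) 2 := by
    rw [thetaLen_two]; omega
  have n02 : (0 : Fin 3) ≠ 2 := by decide
  have n10 : (1 : Fin 3) ≠ 0 := by decide
  have n12 : (1 : Fin 3) ≠ 2 := by decide
  have cc' {i j : ℕ} (hj : j < 2 * k + 3) (hij : i ≤ j) :
      (thetaGraph 2 3 (2 * k + 1)).dist (c i) (c j) =
        min (max i j - min i j) (2 * k + 3 - (max i j - min i j)) := by
    rw [max_eq_right hij, min_eq_left hij]
    rcases Nat.eq_zero_or_pos i with rfl | hi0 <;> rcases Nat.eq_zero_or_pos j with rfl | hj0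
    · simp
    · simp only [c, if_true, hj0.ne', if_false]
      rw [d h0 (h2 hj)]
      simp only [thetaDist, thetaLen_zero, thetaLen_two, n02, if_false]
      omega
    · omega
    · simp only [c, hi0.ne', hj0.ne', if_false]
      rw [d (h2 (hij.trans_lt hj)) (h2 hj)]
      simp only [thetaDist, thetaLen_two, if_true]
      rw [max_eq_right (by omega), min_eq_left (a := i - 1) (by omega)]
      omega
  have cc {i j : ℕ} (hi : i < 2 * k + 3) (hj : j < 2 * k + 3) :
      (thetaGraph 2 3 (2 * k + 1)).dist (c i) (c j) =
        min (max i j - min i j) (2 * k + 3 - (max i j - min i j)) := by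
    rcases le_total i j with h | h
    · exact cc' hj h
    · rw [SimpleGraph.dist_comm, max_comm, min_comm i j]
      exact cc' hi h
  have yc {j : ℕ} (hj : j < 2 * k + 3) : (thetaGraph 2 3 (2 * k + 1)).dist y (c j) =
      if j = 0 then 2 else min j (2 * k + 4 - j) := by
    split_ifs with hj0
    · simp only [c, hj0, if_true]
      rw [d h1 h0]
      simp [thetaDist, n10]
    · simp only [c, hj0, if_false]
      rw [d h1 (h2 hj)]
      simp only [thetaDist, thetaLen_one, thetaLen_two, n12, if_false]
      omega
  clear_value c y
  have sc {i : ℕ} (hi : i < 2 * k + 3) :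
      ∑ j : Fin (2 * k + 3), ((thetaGraph 2 3 (2 * k + 1)).dist (c i) (c j) : ℤ) =
        (k + 1) * (k + 2) := by
    rw [Fin.sum_univ_eq_sum_range
      (fun j => ((thetaGraph 2 3 (2 * k + 1)).dist (c i) (c j) : ℤ)) (2 * k + 3)]
    have := sum_range_cycle_dist k i hi
    rw [← Finset.sum_congr rfl fun j hj => cc hi (Finset.mem_range.1 hj)] at this
    exact_mod_cast this
  have sy : ∑ j : Fin (2 * k + 3), ((thetaGraph 2 3 (2 * k + 1)).dist y (c j) : ℤ) =
      (k + 2) ^ 2 + 1 := by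
    rw [Fin.sum_univ_eq_sum_range
      (fun j => ((thetaGraph 2 3 (2 * k + 1)).dist y (c j) : ℤ)) (2 * k + 3)]
    have := sum_range_dist_to_cycle k
    rw [← Finset.sum_congr rfl fun j hj => yc (Finset.mem_range.1 hj)] at this
    exact_mod_cast this
  have h := hG.sum_sum_mul_dist_nonpos
    (Sum.elim ![y, c (k + 2), c 0, c (k + 1)] (fun j : Fin (2 * k + 3) => c j))
    (Sum.elim ![2 * k + 3, 2 * (2 * k + 3), 2 * (2 * k + 3), 2 * k + 3] (fun _ => -6)) (by
      simp [Fintype.sum_sum_type, Fin.sum_univ_four]; ring)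
  simp only [Fintype.sum_sum_type, Sum.elim_inl, Sum.elim_inr, Finset.sum_add_distrib,
    ← Finset.mul_sum] at h
  rw [Finset.sum_comm (s := (Finset.univ : Finset (Fin (2 * k + 3))))
    (t := (Finset.univ : Finset (Fin 4)))] at h
  simp only [sc (Fin.is_lt _)] at h
  simp only [SimpleGraph.dist_comm (u := c (Fin.val _))
    (v := (![y, c (k + 2), c 0, c (k + 1)] : Fin 4 → _) _), ← Finset.mul_sum] at h
  simp [Fin.sum_univ_four, sc (i := k + 2) (by omega), sc (i := 0) (by omega),
    sc (i := k + 1) (by omega), sy] at h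
  have e1 := yc (j := k + 2) (by omega)
  have e2 := yc (j := k + 1) (by omega)
  have e3 := yc (j := 0) (by omega)
  have e4 := cc (i := k + 2) (j := 0) (by omega) (by omega)
  have e5 := cc (i := k + 2) (j := k + 1) (by omega) (by omega)
  have e6 := cc (i := k + 1) (j := 0) (by omega) (by omega)
  rw [if_neg (by omega), show min (k + 2) (2 * k + 4 - (k + 2)) = k + 2 by omega] at e1
  rw [if_neg (by omega), show min (k + 1) (2 * k + 4 - (k + 1)) = k + 1 by omega] at e2
  rw [if_pos rfl] at e3
  replace e4 := e4.trans (c := k + 1) (by omega)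
  replace e5 := e5.trans (c := 1) (by omega)
  replace e6 := e6.trans (c := k + 1) (by omega)
  rw [SimpleGraph.dist_comm (u := c (k + 2)) (v := y), SimpleGraph.dist_comm (u := c 0) (v := y),
    SimpleGraph.dist_comm (u := c (k + 1)) (v := y),
    SimpleGraph.dist_comm (u := c 0) (v := c (k + 2)),
    SimpleGraph.dist_comm (u := c 0) (v := c (k + 1)),
    SimpleGraph.dist_comm (u := c (k + 1)) (v := c (k + 2)), e1, e2, e3, e4, e5, e6] at h
  push_cast at h
  have hk' : (4 : ℤ) ≤ k := by exact_mod_cast hk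
  have : (0 : ℤ) < (2 * k + 3) * (2 * k - 6) := by apply mul_pos <;> linarith
  linarith

/-! ### Two cycles sharing an edge -/

/-- The number of elements of the symmetric difference of the intervals `[a, b)` and `[c, d)`. -/
def symmDiffCard (a b c d : ℕ) : ℕ := (b - a) + (d - c) - 2 * (min b d - max a c)

theorem symmDiffCard_comm (a b c d : ℕ) : symmDiffCard a b c d = symmDiffCard c d a b := by
  simp only [symmDiffCard]; omega

theorem sum_sq_indicator_sub (M a b c d : ℕ) (hb : b ≤ M) (hd : d ≤ M) :
    ∑ i : Fin M, ((if (i : ℕ) ∈ Finset.Ico a b then (1 : ℝ) else 0) -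
      (if (i : ℕ) ∈ Finset.Ico c d then (1 : ℝ) else 0)) ^ 2 = (symmDiffCard a b c d : ℝ) := by
  have card (x y : ℕ) (hy : y ≤ M) :
      ∑ i ∈ Finset.range M, (if i ∈ Finset.Ico x y then (1 : ℝ) else 0) = (y - x : ℕ) := by
    rw [Finset.sum_ite_mem, Finset.inter_eq_right.2 fun i hi => by
      simp only [Finset.mem_Ico, Finset.mem_range] at *; omega]
    simp
  rw [Fin.sum_univ_eq_sum_range (fun i => ((if i ∈ Finset.Ico a b then (1 : ℝ) else 0) -
      (if i ∈ Finset.Ico c d then (1 : ℝ) else 0)) ^ 2) M]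
  rw [Finset.sum_congr rfl (g := fun i => (if i ∈ Finset.Ico a b then (1 : ℝ) else 0) +
      (if i ∈ Finset.Ico c d then 1 else 0) -
      2 * (if i ∈ Finset.Ico (max a c) (min b d) then 1 else 0)) (fun i _ => by
    have : i ∈ Finset.Ico (max a c) (min b d) ↔ i ∈ Finset.Ico a b ∧ i ∈ Finset.Ico c d := by
      simp only [Finset.mem_Ico]; omega
    by_cases h1 : i ∈ Finset.Ico a b <;> by_cases h2 : i ∈ Finset.Ico c d <;>
      simp only [this, h1, h2, and_true, and_false, if_true, if_false] <;> norm_num)]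
  have hle : 2 * (min b d - max a c) ≤ (b - a) + (d - c) := by omega
  rw [Finset.sum_sub_distrib, Finset.sum_add_distrib, ← Finset.mul_sum, card a b hb, card c d hd,
    card _ _ ((min_le_left b d).trans hb), symmDiffCard, Nat.cast_sub hle]
  push_cast
  ring

/-- The alternating cuts of `Θ(1, β, γ)` form four families of consecutive cuts and two single
cuts. Within each of them the indices of the cuts that contain a given vertex form an interval
`[thetaCutLo, thetaCutHi)`. The first two families are the cuts of the cycle of length `β + 1`
that do not separate the endpoints, one for each of the widths `w = ⌊(β + 1) / 2⌋` and
`w = ⌈(β + 1) / 2⌉`: the cut number `i` contains the vertices `y l` with `i < l ≤ i + w`. The next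
two families are those of the cycle of length `γ + 1`. The two single cuts separate the endpoints,
and each of them joins the narrower half of one cycle to the wider half of the other. On an even
cycle both widths agree and every cut occurs twice. -/
def thetaCutLo (β γ : ℕ) : Fin 3 × ℕ → Fin 6 → ℕ
  | (0, _) => ![0, 0, 0, 0, 0, 0]
  | (1, l) => ![l - (β + 1) / 2, l - (β + 2) / 2, 0, 0, 0, 0]
  | (2, l) => ![0, 0, l - (γ + 1) / 2, l - (γ + 2) / 2, 0, 0]

/-- The right ends of the intervals described at `thetaCutLo`. -/
def thetaCutHi (β γ : ℕ) : Fin 3 × ℕ → Fin 6 → ℕ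
  | (0, l) => ![0, 0, 0, 0, 1 - l, 1 - l]
  | (1, l) => ![min l ((β + 2) / 2 - 1), min l ((β + 1) / 2 - 1), 0, 0,
      if l < (β + 1) / 2 then 1 else 0, if l < (β + 2) / 2 then 1 else 0]
  | (2, l) => ![0, 0, min l ((γ + 2) / 2 - 1), min l ((γ + 1) / 2 - 1),
      if l < (γ + 2) / 2 then 1 else 0, if l < (γ + 1) / 2 then 1 else 0]

theorem thetaCutHi_le {β γ : ℕ} (hβ : 1 ≤ β) (p : Fin 3 × ℕ) (k : Fin 6) :
    thetaCutHi β γ p k ≤ β + γ := by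
  obtain ⟨c, l⟩ := p
  fin_cases c <;> fin_cases k <;> simp [thetaCutHi] <;> (try split_ifs) <;> omega

/-- Two vertices of a cycle of length `n + 1` are separated by twice as many alternating cuts as
their distance. -/
theorem symmDiffCard_same_cycle {n l m : ℕ} (hn : 1 ≤ n) (hl : l ≤ n) (hm : m ≤ n) :
    symmDiffCard (l - (n + 1) / 2) (min l ((n + 2) / 2 - 1))
        (m - (n + 1) / 2) (min m ((n + 2) / 2 - 1)) +
      symmDiffCard (l - (n + 2) / 2) (min l ((n + 1) / 2 - 1))
        (m - (n + 2) / 2) (min m ((n + 1) / 2 - 1)) +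
      symmDiffCard 0 (if l < (n + 1) / 2 then 1 else 0) 0 (if m < (n + 1) / 2 then 1 else 0) +
      symmDiffCard 0 (if l < (n + 2) / 2 then 1 else 0) 0 (if m < (n + 2) / 2 then 1 else 0) =
    2 * min (max l m - min l m) (n + 1 - (max l m - min l m)) := by
  obtain ⟨h, r, hr, rfl⟩ : ∃ h r, r ≤ 1 ∧ n = 2 * h + 1 + r :=
    ⟨(n - 1) / 2, (n - 1) % 2, by omega, by omega⟩
  rw [show (2 * h + 1 + r + 1) / 2 = h + 1 by omega,
    show (2 * h + 1 + r + 2) / 2 = h + 1 + r by omega]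
  wlog hlm : l ≤ m generalizing l m
  · rw [max_comm, min_comm l m, ← this hm hl (by omega)]
    simp only [symmDiffCard_comm (l - _), symmDiffCard_comm 0 (if l < _ then _ else _)]
  rw [max_eq_right hlm, min_eq_left hlm]
  simp only [symmDiffCard, max_eq_right (Nat.sub_le_sub_right hlm _), max_self]
  split_ifs <;> omega

/-- Two vertices of cycles of lengths `n + 1` and `m + 1` that share an edge are separated by twice
as many alternating cuts as their distance. A cut that does not separate the ends of the common
edge lies in one cycle, so it counts if it contains the vertex of that cycle. -/
theorem symmDiffCard_two_cycles {n m i j : ℕ} (hn : 1 ≤ n) (hm : 1 ≤ m) (hi : i ≤ n)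
    (hj : j ≤ m) :
    (min i ((n + 2) / 2 - 1) - (i - (n + 1) / 2)) + (min i ((n + 1) / 2 - 1) - (i - (n + 2) / 2)) +
      ((min j ((m + 2) / 2 - 1) - (j - (m + 1) / 2)) +
        (min j ((m + 1) / 2 - 1) - (j - (m + 2) / 2))) +
      symmDiffCard 0 (if i < (n + 1) / 2 then 1 else 0) 0 (if j < (m + 2) / 2 then 1 else 0) +
      symmDiffCard 0 (if i < (n + 2) / 2 then 1 else 0) 0 (if j < (m + 1) / 2 then 1 else 0) =
    2 * min (min (i + j) (n - i + (m - j))) (min (i + (m - j) + 1) (n - i + j + 1)) := by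
  obtain ⟨h, r, hr, rfl⟩ : ∃ h r, r ≤ 1 ∧ n = 2 * h + 1 + r :=
    ⟨(n - 1) / 2, (n - 1) % 2, by omega, by omega⟩
  obtain ⟨h', r', hr', rfl⟩ : ∃ h r, r ≤ 1 ∧ m = 2 * h + 1 + r :=
    ⟨(m - 1) / 2, (m - 1) % 2, by omega, by omega⟩
  rw [show (2 * h + 1 + r + 1) / 2 = h + 1 by omega,
    show (2 * h + 1 + r + 2) / 2 = h + 1 + r by omega,
    show (2 * h' + 1 + r' + 1) / 2 = h' + 1 by omega,
    show (2 * h' + 1 + r' + 2) / 2 = h' + 1 + r' by omega]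
  -- the cuts that contain a vertex without separating the endpoints
  have key {h r i : ℕ} (hr : r ≤ 1) (hi : i ≤ 2 * h + 1 + r) :
      (min i (h + 1 + r - 1) - (i - (h + 1))) + (min i (h + 1 - 1) - (i - (h + 1 + r))) =
        if i < h + 1 then 2 * i else if i < h + 1 + r then 2 * i - 1
          else 2 * (2 * h + 1 + r - i) := by
    split_ifs <;> omega
  rw [key hr hi, key hr' hj]
  simp only [symmDiffCard]
  clear key
  split_ifs <;> simp only [min_self, Nat.min_zero, Nat.zero_min, max_self, Nat.sub_self,
    Nat.sub_zero] <;> omega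

/-- In `Θ(1, β, γ)` twice the distance of two vertices is the number of alternating cuts that
separate them. -/
theorem sum_symmDiffCard_thetaCut {β γ : ℕ} (hβ : 1 ≤ β) (hγ : 1 ≤ γ) {p q : Fin 3 × ℕ}
    (hp : p.2 ≤ thetaLen 1 β γ p.1) (hq : q.2 ≤ thetaLen 1 β γ q.1) :
    ∑ k, symmDiffCard (thetaCutLo β γ p k) (thetaCutHi β γ p k) (thetaCutLo β γ q k)
      (thetaCutHi β γ q k) = 2 * thetaDist 1 β γ p q := by
  wlog hpq : p.1 ≤ q.1 generalizing p q
  · rw [thetaDist_comm, ← this hq hp (by omega)]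
    exact Finset.sum_congr rfl fun k _ => symmDiffCard_comm _ _ _ _
  -- the endpoints, as vertices of the path `0`, are contained in no cut of the first families
  have z1 (a b : ℕ) : symmDiffCard 0 0 a b = b - a := by simp [symmDiffCard]
  have z2 (a b : ℕ) : symmDiffCard a b 0 0 = b - a := by simp [symmDiffCard]
  have n01 : (0 : Fin 3) ≠ 1 := by decide
  have n02 : (0 : Fin 3) ≠ 2 := by decide
  have n12 : (1 : Fin 3) ≠ 2 := by decide
  have same_cycle {n i j : ℕ} (hi : i ≤ n) (hj : j ≤ n) :
      min (min (min (i + j) (n - i + (n - j))) (min (i + (n - j) + 1) (n - i + j + 1)))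
        (max i j - min i j) = min (max i j - min i j) (n + 1 - (max i j - min i j)) := by omega
  have two_cycles {n m i j : ℕ} (hi : i ≤ n) (hj : j ≤ m) :
      min (min (min (i + j) (n - i + (m - j))) (min (i + (m - j) + 1) (n - i + j + 1))) (i + j) =
        min (min (i + j) (n - i + (m - j))) (min (i + (m - j) + 1) (n - i + j + 1)) := by omega
  have endpoint_cycle {n i j : ℕ} (hn : 1 ≤ n) (hi : i ≤ 1) (hj : j ≤ n) :
      min j ((n + 2) / 2 - 1) - (j - (n + 1) / 2) + (min j ((n + 1) / 2 - 1) - (j - (n + 2) / 2)) +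
        (0 - 0) + (0 - 0) + symmDiffCard 0 (1 - i) 0 (if j < (n + 1) / 2 then 1 else 0) +
        symmDiffCard 0 (1 - i) 0 (if j < (n + 2) / 2 then 1 else 0) =
      2 * min (min (min (i + j) (1 - i + (n - j))) (min (i + (n - j) + 1) (1 - i + j + 1)))
        (i + j) := by
    have hi' : i = 0 ∨ i = 1 := by omega
    simp only [symmDiffCard]
    rcases hi' with rfl | rfl <;> split_ifs <;> omega
  obtain ⟨c, i⟩ := p
  obtain ⟨c', j⟩ := q
  fin_cases c <;> fin_cases c' <;> simp only [Fin.zero_eta, Fin.mk_one, Fin.reduceFinMk] at * <;>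
    first
    | (exfalso; revert hpq; decide)
    | skip
  all_goals
    simp only [Fin.sum_univ_six, thetaCutLo, thetaCutHi, Matrix.cons_val, thetaDist,
      thetaLen_zero, thetaLen_one, thetaLen_two, n01, n02, n12, if_true, if_false, z1, z2] at *
  · have hi : i = 0 ∨ i = 1 := by omega
    have hj : j = 0 ∨ j = 1 := by omega
    rcases hi with rfl | rfl <;> rcases hj with rfl | rfl <;> simp [symmDiffCard]
  · exact endpoint_cycle hβ hp hq
  · have := endpoint_cycle hγ hp hq
    omega
  · rw [same_cycle hp hq, ← symmDiffCard_same_cycle hβ hp hq]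
    omega
  · rw [two_cycles hp hq, ← symmDiffCard_two_cycles hβ hγ hp hq]
    omega
  · rw [same_cycle hp hq, ← symmDiffCard_same_cycle hγ hp hq]
    omega

theorem isQEClass_one {β γ : ℕ} (hβ : 1 ≤ β) (hγ : 1 ≤ γ) : IsQEClass (thetaGraph 1 β γ) := by
  let f (v : ThetaVertex 1 β γ) (k : Fin 6 × Fin (β + γ)) : ℝ :=
    if (k.2 : ℕ) ∈ Finset.Ico (thetaCutLo β γ (thetaLabel v) k.1) (thetaCutHi β γ (thetaLabel v) k.1)
      then 1 else 0
  refine isQEClass_of_sum_sq (thetaGraph_connected le_rfl) (fun _ => 1 / 2)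
    (fun _ => by norm_num) f fun u v => ?_
  have hd := dist_thetaPt le_rfl hβ hγ (thetaLabel_snd_le u) (thetaLabel_snd_le v)
  rw [thetaPt_thetaLabel le_rfl, thetaPt_thetaLabel le_rfl] at hd
  rw [← Finset.mul_sum, Fintype.sum_prod_type, hd]
  simp only [f]
  simp only [sum_sq_indicator_sub _ _ _ _ _ (thetaCutHi_le hβ _ _) (thetaCutHi_le hβ _ _)]
  have := sum_symmDiffCard_thetaCut hβ hγ (thetaLabel_snd_le u) (thetaLabel_snd_le v)
  rw [← Nat.cast_sum, this]
  push_cast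
  ring

/-! ### The three sporadic graphs -/

/-- A quadratic embedding of `Θ(2, 3, γ)` for `γ ≤ 7`, scaled coordinatewise: the squared
distances are the sums of the squared differences with the weights `sporadicWeight / 120`. It
comes from a Cholesky decomposition of the Gram matrix with the vertex `x 1` as the origin. -/
def sporadicCoord : ℕ → Fin 3 × ℕ → Fin 8 → ℤ
  | _, (0, 0) => ![2, 0, 0, 0, 0, 0, 0, 0]
  | _, (0, 1) => 0
  | _, (0, 2) => ![0, 2, 0, 0, 0, 0, 0, 0]
  | _, (1, 1) => ![2, 1, 3, 0, 0, 0, 0, 0]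
  | _, (1, 2) => ![1, 2, 2, 5, 0, 0, 0, 0]
  | 3, (2, 1) => ![2, 1, -1, -4, 1, 0, 0, 0]
  | 3, (2, 2) => ![1, 2, -2, 1, 1, 0, 0, 0]
  | 5, (2, 1) => ![2, 0, 0, 0, 2, 0, 0, 0]
  | 5, (2, 2) => ![2, 1, -1, -4, 2, 0, 4, 0]
  | 5, (2, 3) => ![1, 2, -2, 1, 2, 0, 4, 0]
  | 5, (2, 4) => ![0, 2, 0, 0, 1, 0, 5, 1]
  | 7, (2, 1) => ![2, 0, 0, 0, 2, 0, 0, 0]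
  | 7, (2, 2) => ![2, 0, 0, 0, 2, 2, 0, 0]
  | 7, (2, 3) => ![2, 1, -1, -4, 2, 2, 4, 0]
  | 7, (2, 4) => ![1, 2, -2, 1, 2, 2, 4, 0]
  | 7, (2, 5) => ![0, 2, 0, 0, 1, 2, 5, 1]
  | 7, (2, 6) => ![0, 2, 0, 0, 0, 1, 5, -1]
  | _, _ => 0

/-- The weights of the coordinates in `sporadicCoord`, multiplied by `120`. -/
def sporadicWeight : ℕ → Fin 8 → ℕ
  | 3 => ![30, 30, 10, 2, 48, 0, 0, 0]
  | _ => ![30, 30, 10, 2, 30, 30, 3, 15]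

theorem isQEClass_of_sporadicCoord {γ : ℕ} (hγ : 2 ≤ γ)
    (h : ∀ u v : ThetaVertex 2 3 γ, ∑ k, (sporadicWeight γ k : ℤ) *
      (sporadicCoord γ (thetaLabel u) k - sporadicCoord γ (thetaLabel v) k) ^ 2 =
        120 * thetaDist 2 3 γ (thetaLabel u) (thetaLabel v)) :
    IsQEClass (thetaGraph 2 3 γ) := by
  refine isQEClass_of_sum_sq (thetaGraph_connected (by norm_num))
    (fun k => (sporadicWeight γ k : ℝ) / 120) (fun k => by positivity)
    (fun v k => sporadicCoord γ (thetaLabel v) k) fun u v => ?_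
  have hd := dist_thetaPt (by norm_num) (by norm_num) hγ (thetaLabel_snd_le u)
    (thetaLabel_snd_le v)
  rw [thetaPt_thetaLabel (by norm_num), thetaPt_thetaLabel (by norm_num)] at hd
  have h' : ∑ k, (sporadicWeight γ k : ℝ) *
      ((sporadicCoord γ (thetaLabel u) k : ℝ) - sporadicCoord γ (thetaLabel v) k) ^ 2 =
        120 * thetaDist 2 3 γ (thetaLabel u) (thetaLabel v) := by exact_mod_cast h u v
  simp only [div_mul_eq_mul_div]
  rw [← Finset.sum_div, h', hd]
  ring

theorem isQEClass_two_three_three : IsQEClass (thetaGraph 2 3 3) :=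
  isQEClass_of_sporadicCoord (by norm_num) (by decide)

theorem isQEClass_two_three_five : IsQEClass (thetaGraph 2 3 5) :=
  isQEClass_of_sporadicCoord (by norm_num) (by decide)

theorem isQEClass_two_three_seven : IsQEClass (thetaGraph 2 3 7) :=
  isQEClass_of_sporadicCoord (by norm_num) (by decide)

theorem theorem1 (α β γ : ℕ) (hα : 1 ≤ α) (hαβ : α ≤ β) (hβγ : β ≤ γ) (hβ : 2 ≤ β) :
    IsQEClass (thetaGraph α β γ) ↔
      α = 1 ∨ (α = 2 ∧ β = 3 ∧ (γ = 3 ∨ γ = 5 ∨ γ = 7)) := by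
  constructor
  · intro hG
    by_contra! hne
    obtain ⟨hα1, hne⟩ := hne
    have hα2 : 2 ≤ α := by omega
    -- some cycle through the path `0` is even unless `β` and `γ` have the parity opposite to `α`
    have h1 : ¬ Even (α + β) := fun he =>
      not_isQEClass_of_even_add hα2 hαβ (hαβ.trans hβγ) (b := 1) (c := 2) (by decide) (by decide)
        (by decide) he hG
    have h2 : ¬ Even (α + γ) := fun he =>
      not_isQEClass_of_even_add hα2 hαβ (hαβ.trans hβγ) (b := 2) (c := 1) (by decide) (by decide)
        (by decide) he hG
    rw [Nat.not_even_iff_odd] at h1 h2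
    obtain rfl | hα3 : α = 2 ∨ 3 ≤ α := by omega
    · rw [Nat.odd_iff] at h1 h2
      obtain rfl | hβ5 : β = 3 ∨ 5 ≤ β := by omega
      · have := hne rfl rfl
        refine not_isQEClass_two_three ((γ - 1) / 2) (by omega) ?_
        rwa [show 2 * ((γ - 1) / 2) + 1 = γ by omega]
      · refine not_isQEClass_two_odd_odd ((β - 5) / 2) ((γ - 5) / 2) ?_
        rwa [show 2 * ((β - 5) / 2) + 5 = β by omega, show 2 * ((γ - 5) / 2) + 5 = γ by omega]
    · refine not_isQEClass_of_odd_add hα3 hαβ hβγ h1 ?_ hG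
      rw [Nat.odd_iff] at h1 h2
      rw [Nat.even_iff]
      omega
  · rintro (rfl | ⟨rfl, rfl, rfl | rfl | rfl⟩)
    · exact isQEClass_one (by omega) (by omega)
    · exact isQEClass_two_three_three
    · exact isQEClass_two_three_five
    · exact isQEClass_two_three_seven
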